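/- Let $n,m\ge 0$ be integers and let $a=(a(i,j))_{1\le i\le n,\,1\le j\le m}$ be an array of non-negative real masses, $a(i,j)$ being the mass of the box in column $i$ and row $j$ (rows numbered from the bottom). Write $(\int\!\!\int a)(x,y)=\sum_{i\le x,\,j\le y}a(i,j)$ for integers $x,y\ge 0$ (boxes outside the $n\times m$ rectangle contribute nothing). For $1\le j\le m-1$ the operation $D_j$ is defined as follows. Put $\beta_i=\sum_{k\le i}a(k,j+1)-\sum_{k<i}a(k,j)$ for $1\le i\le n$, and let $i$ be the smallest index at which $\beta$ is maximal; $D_j$ moves the mass $\min\bigl(1,\ \beta_i-\max(0,\beta_1,\dots,\beta_{i-1})\bigr)$ from the box $(i,j+1)$ down to the box $(i,j)$ (if $n=0$ it does nothing). An array fixed by $D_1,\dots,D_{m-1}$ is called $\mathbf D$-tight. A down-condensation of $a$ is a $\mathbf D$-tight array obtained from $a$ by applying finitely many operations $D_1,\dots,D_{m-1}$ in any order. The operations $L_i(a)=(D_i(a^T))^T$, $1\le i\le n-1$, with $a^T(j,i)=a(i,j)$, define $\mathbf L$-tight arrays and left-condensations in the same way. **Theorem 2.** The array $a$ has exactly one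 down-condensation $\mathbf Da$ and exactly one left-condensation $\mathbf La$. Let $F$ be the function on the prism $\{(x,y,z)\in\mathbb Z^3: 0\le x\le n,\ 0\le y\le z\le m\}$ obtained by the octahedron recurrence from zero values on the faces $y=0$ and $x=0$ and the values $F(x,y,y)=(\int\!\!\int a)(x,y)$ on the slope rectangle $y=z$, that is, $$F(x+1,y,z+1)=\max\bigl(F(x+1,y,z)+F(x,y,z+1),\ F(x,y-1,z)+F(x+1,y+1,z+1)\bigr)-F(x,y,z)$$ for $0\le x<n$ and $1\le y\le z<m$. Then $$F(i,j,m)=\Bigl(\int\!\!\int \mathbf Da\Bigr)(i,j)\quad(0\le i\le n,\ 0\le j\le m),\qquad F(n,j,k)=\Bigl(\int\!\!\int \mathbf La\Bigr)(j,k)\quad(0\le j\le k\le m).$$ -/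

import Mathlib

/-- A filling of the boxes of the rectangle `[0,n] × [0,m]` by real masses. The entry `a i j` is the
mass of the box in column `i + 1` (counted from the left) and row `j + 1` (counted from below). -/
abbrev MassArray (n m : ℕ) : Type := Fin n → Fin m → ℝ

namespace MassArray

/-- The function `∫∫a`: its value at the grid point `(x, y)` is the total mass of the boxes to the
south-west of `(x, y)`. -/
def integral {n m : ℕ} (a : MassArray n m) (x y : ℕ) : ℝ :=
  ∑ i : Fin n, ∑ j : Fin m, if i.val < x ∧ j.val < y then a i j else 0

/-- Reflection of an array in the diagonal. -/
def transpose {n m : ℕ} (a : MassArray n m) : MassArray m n := fun j i => a i j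

/-- For a row `lo` and the row `up` just above it, the mass of `up` in the columns `≤ i` minus the
mass of `lo` in the columns `< i`. -/
def excess {n : ℕ} (lo up : Fin n → ℝ) (i : Fin n) : ℝ :=
  ∑ k ∈ Finset.Iic i, up k - ∑ k ∈ Finset.Iio i, lo k

/-- The column in which mass is moved down is the leftmost one where the excess is maximal. -/
def IsPivot {n : ℕ} (lo up : Fin n → ℝ) (i : Fin n) : Prop :=
  (∀ k, excess lo up k ≤ excess lo up i) ∧ ∀ k, k < i → excess lo up k < excess lo up i

open Classical in
/-- The mass moved down in column `i` by one elementary move: nothing outside the pivot column, and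
in the pivot column at most one unit, and no more than the amount by which the excess there is
larger than `0` and the excesses of all the columns further left. -/
noncomputable def moved {n : ℕ} (lo up : Fin n → ℝ) (i : Fin n) : ℝ :=
  if IsPivot lo up i then
    min 1 (excess lo up i - (Finset.Iio i).fold max 0 (excess lo up))
  else 0

/-- The elementary operation `D_j`: it moves mass from row `j'` to row `j`; it is used for
`j' = j + 1` only. -/
noncomputable def downMove {n m : ℕ} (j j' : Fin m) (a : MassArray n m) : MassArray n m :=
  fun i k =>
    if k = j' then a i j' - moved (fun c => a c j) (fun c => a c j') i
    else if k = j then a i j + moved (fun c => a c j) (fun c => a c j') i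
    else a i k

/-- `b` is obtained from `a` by one of the operations `D_1, …, D_{m-1}`. -/
def DownStep {n m : ℕ} (a b : MassArray n m) : Prop :=
  ∃ j j' : Fin m, j'.val = j.val + 1 ∧ b = downMove j j' a

/-- `a` is fixed by all the operations `D_1, …, D_{m-1}`. -/
def DownTight {n m : ℕ} (a : MassArray n m) : Prop :=
  ∀ j j' : Fin m, j'.val = j.val + 1 → downMove j j' a = a

/-- `d` is a `D`-tight array to which `a` is condensed by finitely many operations
`D_1, …, D_{m-1}`, in any order. -/
def IsDownCondensation {n m : ℕ} (a d : MassArray n m) : Prop :=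
  Relation.ReflTransGen DownStep a d ∧ DownTight d

/-- The same for the operations `L_i`, which are the transposes `L_i a = (D_i aᵀ)ᵀ`. -/
def IsLeftCondensation {n m : ℕ} (a l : MassArray n m) : Prop :=
  IsDownCondensation a.transpose l.transpose

end MassArray

/-- On the prism `{(x, y, z) : 0 ≤ x ≤ n, 0 ≤ y ≤ z ≤ m}`, the function `F` is obtained by the
octahedron recurrence with propagation vector `(1, 0, 1)` from the values `0` on the faces `y = 0`
and `x = 0` and the values `f` on the slope rectangle `y = z`. (Values of `F` outside the prism play
no role.) -/
structure IsOctahedronPropagation (n m : ℕ) (f : ℕ → ℕ → ℝ) (F : ℕ → ℕ → ℕ → ℝ) : Prop where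
  front : ∀ x z, x ≤ n → z ≤ m → F x 0 z = 0
  left : ∀ y z, y ≤ z → z ≤ m → F 0 y z = 0
  slope : ∀ x y, x ≤ n → y ≤ m → F x y y = f x y
  recurrence : ∀ x y z, x + 1 ≤ n → 1 ≤ y → y ≤ z → z + 1 ≤ m →
    F (x + 1) y (z + 1) =
      max (F (x + 1) y z + F x y (z + 1)) (F x (y - 1) z + F (x + 1) (y + 1) (z + 1)) - F x y z

/-- The propagated function, in the coordinates `x`, `y`, `z - y`. -/
noncomputable def octahedronAux (f : ℕ → ℕ → ℝ) : ℕ → ℕ → ℕ → ℝ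
  | 0, _, _ => 0
  | _ + 1, 0, _ => 0
  | x + 1, y + 1, 0 => f (x + 1) (y + 1)
  | x + 1, y + 1, d + 1 =>
      max (octahedronAux f (x + 1) (y + 1) d + octahedronAux f x (y + 1) (d + 1))
        (octahedronAux f x y (d + 1) + octahedronAux f (x + 1) (y + 2) d)
        - octahedronAux f x (y + 1) d
  termination_by x _ d => (x, d)

/-- The initial data of an array can always be propagated. -/
theorem exists_isOctahedronPropagation {n m : ℕ} (a : MassArray n m) :
    ∃ F, IsOctahedronPropagation n m a.integral F := by
  refine ⟨fun x y z => octahedronAux a.integral x y (z - y), ?_, ?_, ?_, ?_⟩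
  · rintro (_ | x) z _ _ <;> simp [octahedronAux]
  · intro y z _ _
    simp [octahedronAux]
  · rintro (_ | x) (_ | y) _ _ <;> simp [octahedronAux, MassArray.integral]
  · rintro x (_ | y) z _ hy hyz _
    · omega
    · obtain ⟨d, rfl⟩ := Nat.exists_eq_add_of_le hyz
      have h1 : y + 1 + d + 1 - (y + 1) = d + 1 := by omega
      have h2 : y + 1 + d - (y + 1) = d := by omega
      have h3 : y + 1 + d - y = d + 1 := by omega
      have h4 : y + 1 + d + 1 - (y + 1 + 1) = d := by omega
      simp only [h1, h2, h3, h4, Nat.add_sub_cancel]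
      rw [octahedronAux]

/-! Encode an array by the row functions of its integral. A move `D_j` changes just one of them, and
repeating it until nothing moves yields `rowOp`, a max-plus local rule in that row and its two
neighbours. The operators `rowOp j` are idempotent, commute at distance at least two and satisfy the
braid relation (`rowOp_braid`), so they generate a quotient of a 0-Hecke monoid. `insertion m` is a
word for its longest element and absorbs every `rowOp j` with `j + 1 < m`, on either side.

A single move is invisible to `rowOp j`, hence to `insertion m`, while tight arrays are fixed by
`insertion m`. So every condensation has the rows `insertion m a.rows`; it exists because each
`rowOp` is realised by finitely many moves.

The partial words `insertion z` satisfy the octahedron recurrence, so `F x y z = insertion z a.rows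
y x`, and `z = m` gives the down-condensation. For the left one, this function is extended to an
octant, where the recurrence and the data determining the solution are symmetric under exchanging
`x` and `z` together with transposing `a` (`octant_transpose`). -/

open Finset

/-! ### Row operators and their 0-Hecke relations. -/

/-- The row function produced by the octahedron recurrence from a row `I` and its two neighbours:
`L` below and `U` above. -/
noncomputable def condense (L I U : ℕ → ℝ) : ℕ → ℝ
  | 0 => I 0
  | x + 1 => max (I (x + 1) + condense L I U x) (U (x + 1) + L x) - I x

/-- Replace the row `j + 1` of a family of row functions by its condensation. -/
noncomputable def rowOp (j : ℕ) (f : ℕ → ℕ → ℝ) : ℕ → ℕ → ℝ :=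
  Function.update f (j + 1) (condense (f j) (f (j + 1)) (f (j + 2)))

/-- Condense the rows `k, k - 1, …, 1`, in this order. -/
noncomputable def sweep : ℕ → (ℕ → ℕ → ℝ) → ℕ → ℕ → ℝ
  | 0, f => f
  | k + 1, f => sweep k (rowOp k f)

/-- Insert the rows `1, …, z` one after another. -/
noncomputable def insertion : ℕ → (ℕ → ℕ → ℝ) → ℕ → ℕ → ℝ
  | 0, f => f
  | z + 1, f => sweep z (insertion z f)

theorem le_condense (L I U : ℕ → ℝ) (x : ℕ) : I x ≤ condense L I U x := by
  induction x with
  | zero => exact le_rfl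
  | succ x ih =>
    rw [condense]
    linarith [le_max_left (I (x + 1) + condense L I U x) (U (x + 1) + L x)]

/-- In a condensed row the sum of two consecutive values already dominates `U (x + 1) + L x`, so the
first branch of the maximum always wins. -/
theorem condense_idem (L I U : ℕ → ℝ) : condense L (condense L I U) U = condense L I U := by
  funext x
  induction x with
  | zero => rfl
  | succ x ih =>
    have h : U (x + 1) + L x ≤ condense L I U (x + 1) + condense L I U x := by
      have h1 := le_condense L I U x
      rw [condense]
      linarith [le_max_right (I (x + 1) + condense L I U x) (U (x + 1) + L x)]
    conv_lhs => rw [condense]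
    rw [ih, max_eq_left h]
    ring

/-- One column of the braid relation. The hypothesis is itself an octahedron relation, tying the two
sides of the braid together; the third conclusion reproduces it in the next column. -/
theorem octahedron_braid_step {o a b p q r s a' b' c' : ℝ} (h : p + s = max (a + q) (b + r)) :
    max (b' + q) (c' + p) - b = max (max (b' + s) (c' + a) - b + q) (c' + r) - s ∧
    max (max (a' + p) (b' + o) - a + r) (max (b' + q) (c' + p) - b + o) - p =
      max (a' + r) (max (b' + s) (c' + a) - b + o) - a ∧
    max (a' + p) (b' + o) - a + (max (b' + s) (c' + a) - b) =
      max (a' + (max (b' + q) (c' + p) - b))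
        (b' + (max (max (a' + p) (b' + o) - a + r) (max (b' + q) (c' + p) - b + o) - p)) := by
  refine ⟨?_, ?_, ?_⟩ <;> grind

/-- The first two conjuncts are the braid relation for the two inner rows; the third is the
invariant that makes the induction on columns close. -/
theorem condense_braid (O A B C : ℕ → ℝ) (hA : A 0 = 0) (hB : B 0 = 0) (x : ℕ) :
    condense (condense O A B) B C x =
      condense (condense O A (condense A B C)) (condense A B C) C x ∧
    condense O (condense O A B) (condense (condense O A B) B C) x =
      condense O A (condense A B C) x ∧
    condense O A B x + condense A B C x =
      max (A x + condense (condense O A B) B C x)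
        (B x + condense O (condense O A B) (condense (condense O A B) B C) x) := by
  induction x with
  | zero => simp [condense, hA, hB]
  | succ x ih =>
    obtain ⟨h1, h2, h3⟩ := ih
    obtain ⟨e1, e2, e3⟩ := octahedron_braid_step (o := O x) (a' := A (x + 1)) (b' := B (x + 1))
      (c' := C (x + 1)) h3
    simp only [condense]
    rw [← h1, ← h2]
    exact ⟨e1, e2, e3⟩

theorem rowOp_same (j : ℕ) (f : ℕ → ℕ → ℝ) :
    rowOp j f (j + 1) = condense (f j) (f (j + 1)) (f (j + 2)) := by simp [rowOp]

theorem rowOp_of_ne {j y : ℕ} (f : ℕ → ℕ → ℝ) (h : y ≠ j + 1) : rowOp j f y = f y := by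
  simp [rowOp, h]

theorem rowOp_zero_right {f : ℕ → ℕ → ℝ} (hf : ∀ y, f y 0 = 0) (j y : ℕ) :
    rowOp j f y 0 = 0 := by
  by_cases h : y = j + 1
  · subst h; rw [rowOp_same, condense, hf]
  · rw [rowOp_of_ne f h, hf]

theorem sweep_zero_right {f : ℕ → ℕ → ℝ} (hf : ∀ y, f y 0 = 0) (k y : ℕ) :
    sweep k f y 0 = 0 := by
  induction k generalizing f with
  | zero => exact hf y
  | succ k ih => exact ih (rowOp_zero_right hf k)

theorem insertion_zero_right {f : ℕ → ℕ → ℝ} (hf : ∀ y, f y 0 = 0) (z y : ℕ) :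
    insertion z f y 0 = 0 := by
  induction z generalizing y with
  | zero => exact hf y
  | succ z ih => exact sweep_zero_right ih z y

theorem rowOp_idem (j : ℕ) (f : ℕ → ℕ → ℝ) : rowOp j (rowOp j f) = rowOp j f := by
  funext y
  by_cases h : y = j + 1
  · subst h
    rw [rowOp_same, rowOp_same, rowOp_of_ne f (by omega), rowOp_of_ne f (by omega), condense_idem]
  · rw [rowOp_of_ne _ h]

theorem rowOp_comm {i j : ℕ} (h : i + 2 ≤ j) (f : ℕ → ℕ → ℝ) :
    rowOp i (rowOp j f) = rowOp j (rowOp i f) := by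
  funext y
  by_cases h1 : y = i + 1
  · subst h1
    rw [rowOp_same, rowOp_of_ne (j := j) _ (by omega), rowOp_of_ne (j := j) _ (by omega),
      rowOp_of_ne (j := j) _ (by omega), rowOp_of_ne (j := j) _ (by omega), rowOp_same]
  · rw [rowOp_of_ne _ h1]
    by_cases h2 : y = j + 1
    · subst h2
      rw [rowOp_same, rowOp_same, rowOp_of_ne (j := i) _ (by omega),
        rowOp_of_ne (j := i) _ (by omega), rowOp_of_ne (j := i) _ (by omega)]
    · rw [rowOp_of_ne _ h2, rowOp_of_ne _ h2, rowOp_of_ne _ h1]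

theorem rowOp_braid (j : ℕ) {f : ℕ → ℕ → ℝ} (hf : ∀ y, f y 0 = 0) :
    rowOp j (rowOp (j + 1) (rowOp j f)) = rowOp (j + 1) (rowOp j (rowOp (j + 1) f)) := by
  have key := condense_braid (f j) (f (j + 1)) (f (j + 2)) (f (j + 3)) (hf _) (hf _)
  have e1 : rowOp (j + 1) f (j + 2) = condense (f (j + 1)) (f (j + 2)) (f (j + 3)) :=
    rowOp_same (j + 1) f
  have e2 : rowOp (j + 1) (rowOp j f) (j + 2) = condense (condense (f j) (f (j + 1)) (f (j + 2)))
      (f (j + 2)) (f (j + 3)) := by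
    rw [show j + 2 = j + 1 + 1 from rfl, rowOp_same, rowOp_same, rowOp_of_ne f (by omega),
      rowOp_of_ne f (by omega)]
  have e3 : rowOp j (rowOp (j + 1) f) (j + 1) = condense (f j) (f (j + 1))
      (condense (f (j + 1)) (f (j + 2)) (f (j + 3))) := by
    rw [rowOp_same, e1, rowOp_of_ne f (by omega), rowOp_of_ne f (by omega)]
  funext y x
  by_cases h1 : y = j + 1
  · subst h1
    rw [rowOp_of_ne (j := j + 1) _ (by omega), e3, rowOp_same, e2,
      rowOp_of_ne (j := j + 1) _ (by omega), rowOp_of_ne (j := j + 1) _ (by omega), rowOp_same,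
      rowOp_of_ne (j := j) _ (by omega)]
    exact (key x).2.1
  · rw [rowOp_of_ne (j := j) _ h1]
    by_cases h2 : y = j + 2
    · subst h2
      rw [e2, show j + 2 = j + 1 + 1 from rfl, rowOp_same, e3, rowOp_of_ne (j := j) _ (by omega),
        e1, rowOp_of_ne (j := j) _ (by omega), rowOp_of_ne (j := j + 1) _ (by omega)]
      exact (key x).1
    · rw [rowOp_of_ne (j := j + 1) _ h2, rowOp_of_ne (j := j + 1) _ h2,
        rowOp_of_ne (j := j) _ h1, rowOp_of_ne (j := j) _ h1, rowOp_of_ne (j := j + 1) _ h2]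

/-! ### Absorption by the longest word. -/

theorem sweep_rowOp_comm {k j : ℕ} (h : k + 1 ≤ j) (f : ℕ → ℕ → ℝ) :
    sweep k (rowOp j f) = rowOp j (sweep k f) := by
  induction k generalizing f with
  | zero => rfl
  | succ k ih => rw [sweep, sweep, rowOp_comm (by omega), ih (by omega)]

theorem insertion_rowOp_comm {z j : ℕ} (h : z ≤ j) (f : ℕ → ℕ → ℝ) :
    insertion z (rowOp j f) = rowOp j (insertion z f) := by
  induction z with
  | zero => rfl
  | succ z ih => rw [insertion, insertion, ih (by omega), sweep_rowOp_comm (by omega)]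

/-- Writing `T_i` for `rowOp i`, this is `(T_0⋯T_k)(T_0⋯T_{k-1})T_k = (T_0⋯T_k)(T_0⋯T_{k-1})`.
Moving the first `T_k` to the right produces `T_k T_{k-1} T_k`; the braid relation turns it into
`T_{k-1} T_k T_{k-1}`, whose leading `T_{k-1}` is absorbed by induction. -/
theorem sweep_sweep_rowOp (k : ℕ) {f : ℕ → ℕ → ℝ} (hf : ∀ y, f y 0 = 0) :
    sweep (k + 1) (sweep k (rowOp k f)) = sweep (k + 1) (sweep k f) := by
  induction k generalizing f with
  | zero => simp only [sweep]; exact rowOp_idem 0 f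
  | succ k ih =>
    have e (g : ℕ → ℕ → ℝ) : sweep (k + 1 + 1) (sweep (k + 1) g) =
        sweep (k + 1) (sweep k (rowOp (k + 1) (rowOp k g))) := by
      rw [sweep_rowOp_comm le_rfl]
      rfl
    rw [e, e, ← rowOp_braid k hf]
    exact ih (rowOp_zero_right (rowOp_zero_right hf _) _)

theorem insertion_rowOp {z j : ℕ} (h : j + 1 < z) {f : ℕ → ℕ → ℝ} (hf : ∀ y, f y 0 = 0) :
    insertion z (rowOp j f) = insertion z f := by
  induction z with
  | zero => omega
  | succ z ih =>
    rcases Nat.lt_or_ge (j + 1) z with h' | h'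
    · rw [insertion, insertion, ih h']
    · obtain rfl : z = j + 1 := by omega
      simp only [insertion]
      rw [insertion_rowOp_comm le_rfl]
      exact sweep_sweep_rowOp j (insertion_zero_right hf j)

theorem insertion_sweep {z k : ℕ} (h : k < z) {f : ℕ → ℕ → ℝ} (hf : ∀ y, f y 0 = 0) :
    insertion z (sweep k f) = insertion z f := by
  induction k generalizing f with
  | zero => rfl
  | succ k ih =>
    rw [sweep, ih (by omega) (rowOp_zero_right hf k), insertion_rowOp (by omega) hf]

theorem insertion_insertion {z k : ℕ} (h : k ≤ z) {f : ℕ → ℕ → ℝ} (hf : ∀ y, f y 0 = 0) :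
    insertion z (insertion k f) = insertion z f := by
  induction k with
  | zero => rfl
  | succ k ih =>
    rw [insertion, insertion_sweep (by omega) (insertion_zero_right hf k), ih (by omega)]

theorem le_rowOp (j : ℕ) (f : ℕ → ℕ → ℝ) : f ≤ rowOp j f := by
  intro y x
  by_cases h : y = j + 1
  · subst h; rw [rowOp_same]; exact le_condense _ _ _ x
  · rw [rowOp_of_ne f h]

theorem le_sweep (k : ℕ) (f : ℕ → ℕ → ℝ) : f ≤ sweep k f := by
  induction k generalizing f with
  | zero => exact le_rfl
  | succ k ih => exact (le_rowOp k f).trans (ih _)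

theorem le_insertion (z : ℕ) (f : ℕ → ℕ → ℝ) : f ≤ insertion z f := by
  induction z with
  | zero => exact le_rfl
  | succ z ih => exact ih.trans (le_sweep z _)

/-- Left absorption follows from right absorption because all operators only increase values: `rowOp
j (insertion z f)` lies between `insertion z f` and its own insertion, which is again `insertion z
f`. -/
theorem rowOp_insertion {z j : ℕ} (h : j + 1 < z) {f : ℕ → ℕ → ℝ} (hf : ∀ y, f y 0 = 0) :
    rowOp j (insertion z f) = insertion z f := by
  refine le_antisymm ?_ (le_rowOp _ _)
  refine (le_insertion z _).trans ?_
  rw [insertion_rowOp h (insertion_zero_right hf z), insertion_insertion le_rfl hf]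

/-! ### The octahedron recurrence for partial insertions. -/

theorem sweep_of_lt {k y : ℕ} (h : k < y) (f : ℕ → ℕ → ℝ) : sweep k f y = f y := by
  induction k generalizing f with
  | zero => rfl
  | succ k ih => rw [sweep, ih (by omega), rowOp_of_ne f (by omega)]

theorem sweep_zero (k : ℕ) (f : ℕ → ℕ → ℝ) : sweep k f 0 = f 0 := by
  induction k generalizing f with
  | zero => rfl
  | succ k ih => rw [sweep, ih, rowOp_of_ne f (by omega)]

/-- A sweep runs downwards: when a row is treated, the row above is already final and the row below
still untouched. -/
theorem sweep_succ_of_lt {k y : ℕ} (h : y < k) (f : ℕ → ℕ → ℝ) :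
    sweep k f (y + 1) = condense (f y) (f (y + 1)) (sweep k f (y + 2)) := by
  induction k generalizing f with
  | zero => omega
  | succ k ih =>
    simp only [sweep]
    rcases Nat.lt_or_ge y k with h' | h'
    · rw [ih h', rowOp_of_ne (y := y) f (by omega), rowOp_of_ne (y := y + 1) f (by omega)]
    · obtain rfl : k = y := by omega
      rw [sweep_of_lt (by omega), sweep_of_lt (by omega), rowOp_same, rowOp_of_ne _ (by omega)]

theorem insertion_of_le {z y : ℕ} (h : z ≤ y) (f : ℕ → ℕ → ℝ) : insertion z f y = f y := by
  induction z with
  | zero => rfl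
  | succ z ih => rw [insertion, sweep_of_lt (by omega), ih (by omega)]

theorem insertion_zero_left (z : ℕ) (f : ℕ → ℕ → ℝ) : insertion z f 0 = f 0 := by
  induction z with
  | zero => rfl
  | succ z ih => rw [insertion, sweep_zero, ih]

theorem insertion_recurrence {x y z : ℕ} (h : y < z) (f : ℕ → ℕ → ℝ) :
    insertion (z + 1) f (y + 1) (x + 1) =
      max (insertion z f (y + 1) (x + 1) + insertion (z + 1) f (y + 1) x)
        (insertion (z + 1) f (y + 2) (x + 1) + insertion z f y x) - insertion z f (y + 1) x := by
  simp only [insertion]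
  rw [sweep_succ_of_lt h]
  rfl

/-- Equality of families of row functions on the columns `0, …, n`. -/
def AgreeUpTo (n : ℕ) (f g : ℕ → ℕ → ℝ) : Prop := ∀ y x, x ≤ n → f y x = g y x

namespace AgreeUpTo

variable {n : ℕ} {f g h : ℕ → ℕ → ℝ}

theorem refl (f : ℕ → ℕ → ℝ) : AgreeUpTo n f f := fun _ _ _ => rfl

theorem symm (hfg : AgreeUpTo n f g) : AgreeUpTo n g f := fun y x hx => (hfg y x hx).symm

theorem trans (hfg : AgreeUpTo n f g) (hgh : AgreeUpTo n g h) : AgreeUpTo n f h :=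
  fun y x hx => (hfg y x hx).trans (hgh y x hx)

theorem rowOp (hfg : AgreeUpTo n f g) (j : ℕ) : AgreeUpTo n (rowOp j f) (rowOp j g) := by
  intro y x hx
  by_cases h : y = j + 1
  · subst h
    rw [rowOp_same, rowOp_same]
    induction x with
    | zero => exact hfg _ _ hx
    | succ x ih =>
      rw [condense, condense, ih (by omega), hfg _ _ hx, hfg _ _ hx, hfg j x (by omega),
        hfg (j + 1) x (by omega)]
  · rw [rowOp_of_ne f h, rowOp_of_ne g h, hfg y x hx]

theorem sweep (hfg : AgreeUpTo n f g) (k : ℕ) : AgreeUpTo n (sweep k f) (sweep k g) := by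
  induction k generalizing f g with
  | zero => exact hfg
  | succ k ih => exact ih (hfg.rowOp k)

theorem insertion (hfg : AgreeUpTo n f g) (z : ℕ) :
    AgreeUpTo n (insertion z f) (insertion z g) := by
  induction z with
  | zero => exact hfg
  | succ z ih => exact ih.sweep z

theorem sweep_of_fixed {k : ℕ} (hf : ∀ j < k, AgreeUpTo n (_root_.rowOp j f) f) :
    AgreeUpTo n (_root_.sweep k f) f := by
  induction k with
  | zero => exact refl f
  | succ k ih =>
    exact ((hf k (by omega)).sweep k).trans (ih fun j hj => hf j (by omega))

theorem insertion_of_fixed {z : ℕ} (hf : ∀ j, j + 1 < z → AgreeUpTo n (_root_.rowOp j f) f) :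
    AgreeUpTo n (_root_.insertion z f) f := by
  induction z with
  | zero => exact refl f
  | succ z ih =>
    exact ((ih fun j hj => hf j (by omega)).sweep z).trans
      (sweep_of_fixed fun j hj => hf j (by omega))

end AgreeUpTo

/-! ### Elementary moves between two adjacent rows. -/

namespace MassArray

/-- The running maximum of `0` and the excesses of the first `x` columns. -/
noncomputable def record {n : ℕ} (lo up : Fin n → ℝ) : ℕ → ℝ
  | 0 => 0
  | x + 1 => if h : x < n then max (record lo up x) (excess lo up ⟨x, h⟩) else record lo up x

section TwoRows

variable {n : ℕ} {lo up : Fin n → ℝ}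

theorem record_succ (lo up : Fin n → ℝ) (i : Fin n) :
    record lo up (i + 1) = max (record lo up i) (excess lo up i) := by
  simp [record]

theorem record_le_iff {x : ℕ} (hx : x ≤ n) {c : ℝ} :
    record lo up x ≤ c ↔ 0 ≤ c ∧ ∀ k : Fin n, k.val < x → excess lo up k ≤ c := by
  induction x with
  | zero => simp [record]
  | succ x ih =>
    have e := record_succ lo up ⟨x, hx⟩
    simp only at e
    rw [e, max_le_iff, ih (by omega)]
    constructor
    · rintro ⟨⟨h0, h1⟩, h2⟩
      refine ⟨h0, fun k hk => ?_⟩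
      rcases Nat.lt_succ_iff_lt_or_eq.1 hk with h | h
      · exact h1 k h
      · rwa [show k = ⟨x, hx⟩ from Fin.ext h]
    · rintro ⟨h0, h1⟩
      exact ⟨⟨h0, fun k hk => h1 k (by omega)⟩, h1 _ (Nat.lt_succ_self x)⟩

theorem record_mono_succ (lo up : Fin n → ℝ) (i : Fin n) :
    record lo up i ≤ record lo up (i + 1) := by
  rw [record_succ]; exact le_max_left _ _

theorem record_nonneg (lo up : Fin n → ℝ) {x : ℕ} (hx : x ≤ n) : 0 ≤ record lo up x :=
  ((record_le_iff hx).1 le_rfl).1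

theorem fold_excess_eq_record (lo up : Fin n → ℝ) (i : Fin n) :
    (Iio i).fold max 0 (excess lo up) = record lo up i := by
  refine eq_of_forall_ge_iff fun c => ?_
  rw [Finset.fold_max_le, record_le_iff i.isLt.le]
  simp only [mem_Iio, Fin.lt_def]

theorem IsPivot.unique {p q : Fin n} (hp : IsPivot lo up p) (hq : IsPivot lo up q) : p = q := by
  rcases lt_trichotomy p q with h | h | h
  · exact absurd (hq.2 p h) (hp.1 q).not_gt
  · exact h
  · exact absurd (hp.2 q h) (hq.1 p).not_gt

theorem exists_isPivot [Nonempty (Fin n)] (lo up : Fin n → ℝ) : ∃ p, IsPivot lo up p := by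
  obtain ⟨q, hq⟩ := Finite.exists_max (excess lo up)
  obtain ⟨p, hp, hmin⟩ := wellFounded_lt.has_min {p | ∀ k, excess lo up k ≤ excess lo up p} ⟨q, hq⟩
  refine ⟨p, hp, fun k hk => lt_of_le_of_ne (hp k) fun h => hmin k ?_ hk⟩
  intro l
  rw [h]
  exact hp l

theorem excess_zero (lo up : Fin n → ℝ) (h : 0 < n) : excess lo up ⟨0, h⟩ = up ⟨0, h⟩ := by
  have e1 : Iic (⟨0, h⟩ : Fin n) = {⟨0, h⟩} := by ext k; simp [Fin.le_def, Fin.ext_iff]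
  have e2 : Iio (⟨0, h⟩ : Fin n) = ∅ := by ext k; simp [Fin.lt_def]
  simp [excess, e1, e2]

theorem excess_succ (lo up : Fin n → ℝ) {x : ℕ} (h : x + 1 < n) :
    excess lo up ⟨x + 1, h⟩ =
      excess lo up ⟨x, by omega⟩ + up ⟨x + 1, h⟩ - lo ⟨x, by omega⟩ := by
  have e1 : Iic (⟨x + 1, h⟩ : Fin n) = insert ⟨x + 1, h⟩ (Iic ⟨x, by omega⟩) := by
    ext k; simp only [mem_Iic, mem_insert, Fin.le_def, Fin.ext_iff]; omega
  have e2 : Iio (⟨x + 1, h⟩ : Fin n) = insert ⟨x, by omega⟩ (Iio ⟨x, by omega⟩) := by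
    ext k; simp only [mem_Iio, mem_insert, Fin.lt_def, Fin.ext_iff]; omega
  rw [excess, excess, e1, e2, sum_insert (by simp), sum_insert (by simp)]
  ring

theorem IsPivot.excess_nonneg (hup : ∀ i, 0 ≤ up i) {p : Fin n} (hp : IsPivot lo up p) :
    0 ≤ excess lo up p := by
  have h := hp.1 ⟨0, p.pos⟩
  rw [excess_zero] at h
  exact (hup _).trans h

theorem IsPivot.record_le (hup : ∀ i, 0 ≤ up i) {p : Fin n} (hp : IsPivot lo up p) {x : ℕ}
    (hx : x ≤ n) : record lo up x ≤ excess lo up p :=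
  (record_le_iff hx).2 ⟨hp.excess_nonneg hup, fun k _ => hp.1 k⟩

theorem IsPivot.record_succ_eq (hup : ∀ i, 0 ≤ up i) {p : Fin n} (hp : IsPivot lo up p) :
    record lo up (p + 1) = excess lo up p := by
  rw [record_succ, max_eq_right (hp.record_le hup p.isLt.le)]

theorem IsPivot.record_of_lt (hup : ∀ i, 0 ≤ up i) {p : Fin n} (hp : IsPivot lo up p) {x : ℕ}
    (hpx : p.val < x) (hx : x ≤ n) : record lo up x = excess lo up p :=
  le_antisymm (hp.record_le hup hx) (((record_le_iff hx).1 le_rfl).2 p hpx)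

theorem IsPivot.moved_eq (hup : ∀ i, 0 ≤ up i) {p : Fin n} (hp : IsPivot lo up p) :
    moved lo up p = min 1 (record lo up (p + 1) - record lo up p) := by
  rw [moved, if_pos hp, fold_excess_eq_record, hp.record_succ_eq hup]

theorem moved_of_not_isPivot {i : Fin n} (hi : ¬ IsPivot lo up i) : moved lo up i = 0 := by
  rw [moved, if_neg hi]

theorem moved_nonneg (hup : ∀ i, 0 ≤ up i) (i : Fin n) : 0 ≤ moved lo up i := by
  by_cases hi : IsPivot lo up i
  · rw [hi.moved_eq hup]
    exact le_min zero_le_one (sub_nonneg.2 (record_mono_succ lo up i))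
  · rw [moved_of_not_isPivot hi]

/-- This keeps masses non-negative under a move: from one column to the next the excess grows by at
most the mass of the upper box. -/
theorem record_succ_sub_le (hlo : ∀ i, 0 ≤ lo i) (hup : ∀ i, 0 ≤ up i) (i : Fin n) :
    record lo up (i + 1) - record lo up i ≤ up i := by
  rw [record_succ, sub_le_iff_le_add']
  refine max_le (by linarith [hup i]) ?_
  obtain ⟨x, hx⟩ := i
  cases x with
  | zero =>
    rw [excess_zero]
    exact le_add_of_nonneg_left (record_nonneg lo up hx.le)
  | succ x =>
    have e := record_succ lo up ⟨x, by omega⟩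
    have h := le_max_right (record lo up x) (excess lo up ⟨x, by omega⟩)
    simp only at e ⊢
    rw [excess_succ, e]
    linarith [hlo ⟨x, by omega⟩]

theorem moved_le (hlo : ∀ i, 0 ≤ lo i) (hup : ∀ i, 0 ≤ up i) (i : Fin n) :
    moved lo up i ≤ up i := by
  by_cases hi : IsPivot lo up i
  · rw [hi.moved_eq hup]
    exact (min_le_right _ _).trans (record_succ_sub_le hlo hup i)
  · rw [moved_of_not_isPivot hi]; exact hup i

theorem record_eq_zero_of_moved_eq_zero (hup : ∀ i, 0 ≤ up i) (h : ∀ i, moved lo up i = 0) {x : ℕ}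
    (hx : x ≤ n) : record lo up x = 0 := by
  rcases Nat.eq_zero_or_pos n with rfl | hn
  · obtain rfl : x = 0 := by omega
    rfl
  have : Nonempty (Fin n) := ⟨⟨0, hn⟩⟩
  obtain ⟨p, hp⟩ := exists_isPivot lo up
  have h0 := h p
  rw [hp.moved_eq hup] at h0
  have h1 : excess lo up p ≤ record lo up p := by
    rw [← hp.record_succ_eq hup]
    rcases min_choice 1 (record lo up (p + 1) - record lo up p) with e | e <;> linarith
  have h2 : excess lo up p ≤ 0 := by
    -- A positive excess at the leftmost maximum strictly beats `0` and all earlier excesses, so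
    -- some mass would move.
    by_contra! hpos
    have : record lo up p < excess lo up p := by
      rw [← fold_excess_eq_record, Finset.fold_max_lt]
      exact ⟨hpos, fun k hk => hp.2 k (by simpa using hk)⟩
    exact absurd h1 this.not_ge
  exact le_antisymm ((hp.record_le hup hx).trans h2) (record_nonneg lo up hx)

theorem moved_eq_zero_of_record_eq_zero (hup : ∀ i, 0 ≤ up i)
    (h : ∀ x ≤ n, record lo up x = 0) (i : Fin n) : moved lo up i = 0 := by
  by_cases hi : IsPivot lo up i
  · rw [hi.moved_eq hup, h _ i.isLt, h _ i.isLt.le]; simp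
  · exact moved_of_not_isPivot hi

/-- The mass moved in the first `x` columns. -/
noncomputable def movedSum (lo up : Fin n → ℝ) (x : ℕ) : ℝ :=
  ∑ i : Fin n, if i.val < x then moved lo up i else 0

theorem sum_lt_succ (g : Fin n → ℝ) (i : Fin n) :
    (∑ k : Fin n, if k.val < i.val + 1 then g k else 0) =
      (∑ k : Fin n, if k.val < i.val then g k else 0) + g i := by
  have : g i = ∑ k : Fin n, if k = i then g k else 0 := by simp
  rw [this, ← sum_add_distrib]
  refine sum_congr rfl fun k _ => ?_
  by_cases h1 : k = i
  · subst h1; simp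
  · have : k.val ≠ i.val := fun h => h1 (Fin.ext h)
    by_cases h2 : k.val < i.val
    · simp [h1, h2, Nat.lt_succ_of_lt h2]
    · have h3 : ¬ k.val < i.val + 1 := by omega
      simp [h1, h2, h3]

theorem excess_eq (lo up : Fin n → ℝ) (i : Fin n) :
    excess lo up i = (∑ k : Fin n, if k.val < i.val + 1 then up k else 0) -
      ∑ k : Fin n, if k.val < i.val then lo k else 0 := by
  rw [excess, ← sum_filter, ← sum_filter]
  congr 2 <;> ext k <;>
    simp only [mem_Iic, mem_Iio, mem_filter, mem_univ, true_and, Fin.le_def, Fin.lt_def,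
      Nat.lt_succ_iff]

theorem IsPivot.movedSum_eq {p : Fin n} (hp : IsPivot lo up p) (x : ℕ) :
    movedSum lo up x = if p.val < x then moved lo up p else 0 := by
  rw [movedSum, Finset.sum_eq_single p]
  · intro k _ hk
    rw [moved_of_not_isPivot fun h => hk (h.unique hp), ite_self]
  · simp

/-- An elementary move lowers the running maximum of the excesses by the mass moved. -/
theorem record_move (hup : ∀ i, 0 ≤ up i) {x : ℕ} (hx : x ≤ n) :
    record (fun i => lo i + moved lo up i) (fun i => up i - moved lo up i) x =
      record lo up x - movedSum lo up x := by
  rcases Nat.eq_zero_or_pos n with rfl | hn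
  · obtain rfl : x = 0 := by omega
    simp [record, movedSum]
  have : Nonempty (Fin n) := ⟨⟨0, hn⟩⟩
  obtain ⟨p, hp⟩ := exists_isPivot lo up
  have hex (i : Fin n) : excess (fun i => lo i + moved lo up i) (fun i => up i - moved lo up i) i =
      excess lo up i - movedSum lo up (i + 1) - movedSum lo up i := by
    have e (c : ℕ) (g g' : Fin n → ℝ) : (∑ k : Fin n, if k.val < c then g k + g' k else 0) =
        (∑ k : Fin n, if k.val < c then g k else 0) +
          ∑ k : Fin n, if k.val < c then g' k else 0 := by
      rw [← sum_add_distrib]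
      exact sum_congr rfl fun k _ => by split_ifs <;> simp
    have e' (c : ℕ) (g g' : Fin n → ℝ) : (∑ k : Fin n, if k.val < c then g k - g' k else 0) =
        (∑ k : Fin n, if k.val < c then g k else 0) -
          ∑ k : Fin n, if k.val < c then g' k else 0 := by
      rw [← sum_sub_distrib]
      exact sum_congr rfl fun k _ => by split_ifs <;> simp
    rw [excess_eq, excess_eq, e, e', movedSum, movedSum]
    ring
  have ht0 := moved_nonneg (lo := lo) hup p
  have ht1 : moved lo up p ≤ excess lo up p - record lo up p := by
    rw [hp.moved_eq hup, hp.record_succ_eq hup]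
    exact min_le_right _ _
  induction x with
  | zero => simp [record, movedSum]
  | succ x ih =>
    have e1 := record_succ lo up ⟨x, hx⟩
    have e2 := record_succ (fun i => lo i + moved lo up i) (fun i => up i - moved lo up i) ⟨x, hx⟩
    simp only at e1 e2
    rw [e2, hex, ih (by omega)]
    simp only [hp.movedSum_eq]
    -- Left of the pivot nothing changes. At the pivot the excess drops by the moved mass, without
    -- falling below the earlier record. Further right it drops by twice that mass, so the pivot's
    -- value remains the record.
    rcases lt_trichotomy x p.val with h | h | h
    · rw [e1, if_neg (by omega), if_neg (by omega)]; simp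
    · have hq : (⟨x, hx⟩ : Fin n) = p := Fin.ext h
      rw [if_neg (by omega), if_pos (by omega), hp.record_of_lt hup (by omega) hx, hq, h,
        max_eq_right (by linarith)]
      ring
    · rw [if_pos (by omega), if_pos (by omega), hp.record_of_lt hup (by omega) hx,
        hp.record_of_lt hup h (by omega), max_eq_left (by linarith [hp.1 ⟨x, hx⟩])]

end TwoRows

/-! ### Arrays, their row functions and down-condensations. -/

section Rows

variable {n m : ℕ}

/-- The row functions of the integral of an array. -/
def rows (a : MassArray n m) (y x : ℕ) : ℝ := a.integral x y

theorem rows_zero_right (a : MassArray n m) (y : ℕ) : a.rows y 0 = 0 := by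
  simp [rows, integral]

theorem rows_zero_left (a : MassArray n m) (x : ℕ) : a.rows 0 x = 0 := by
  simp [rows, integral]

theorem rows_succ_left (a : MassArray n m) (j : Fin m) (x : ℕ) :
    a.rows (j + 1) x = a.rows j x + ∑ i : Fin n, if i.val < x then a i j else 0 := by
  rw [rows, rows, integral, integral, ← sum_add_distrib]
  refine sum_congr rfl fun i _ => ?_
  by_cases hi : i.val < x
  · simp only [hi, true_and, if_true]
    exact sum_lt_succ (a i) j
  · simp [hi]

theorem rows_congr_left (a : MassArray n m) {y y' : ℕ} (h : m ≤ y) (h' : m ≤ y') (x : ℕ) :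
    a.rows y x = a.rows y' x := by
  rw [rows, rows, integral, integral]
  refine sum_congr rfl fun i _ => sum_congr rfl fun j _ => ?_
  have h1 : j.val < y := by omega
  have h2 : j.val < y' := by omega
  simp [h1, h2]

theorem rows_transpose (a : MassArray n m) (x y : ℕ) : a.transpose.rows x y = a.rows y x := by
  rw [rows, rows, integral, integral, sum_comm]
  exact sum_congr rfl fun i _ => sum_congr rfl fun j _ => by simp [transpose, and_comm]

theorem eq_of_agreeUpTo {a b : MassArray n m} (h : AgreeUpTo n a.rows b.rows) : a = b := by
  funext i j
  have e (c : MassArray n m) : c i j =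
      c.rows (j + 1) (i + 1) - c.rows j (i + 1) - (c.rows (j + 1) i - c.rows j i) := by
    rw [rows_succ_left, rows_succ_left, sum_lt_succ]; ring
  have h1 : i.val + 1 ≤ n := i.isLt
  have h2 : i.val ≤ n := i.isLt.le
  rw [e a, e b, h _ _ h1, h _ _ h1, h _ _ h2, h _ _ h2]

theorem excess_rows (a : MassArray n m) {j j' : Fin m} (hj : j'.val = j.val + 1) (i : Fin n) :
    excess (fun c => a c j) (fun c => a c j') i =
      a.rows (j + 2) (i + 1) + a.rows j i - a.rows (j + 1) (i + 1) - a.rows (j + 1) i := by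
  have h := rows_succ_left a j' (i + 1)
  rw [hj] at h
  rw [excess_eq, h, rows_succ_left a j i]
  ring

/-- The excess is a combination of four values of the integral, and subtracting the old row from the
condensation recursion leaves exactly the recursion of `record`. -/
theorem rowOp_rows_eq (a : MassArray n m) {j j' : Fin m} (hj : j'.val = j.val + 1) {x : ℕ}
    (hx : x ≤ n) : rowOp j a.rows (j + 1) x =
      a.rows (j + 1) x + record (fun c => a c j) (fun c => a c j') x := by
  rw [rowOp_same]
  induction x with
  | zero => simp [condense, record]
  | succ x ih =>
    have e := record_succ (fun c => a c j) (fun c => a c j') ⟨x, hx⟩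
    rw [excess_rows a hj] at e
    simp only at e
    rw [condense, ih (by omega), e, ← max_add_add_left, ← max_sub_sub_right]
    congr 1 <;> ring

theorem rows_downMove (a : MassArray n m) {j j' : Fin m} (hj : j'.val = j.val + 1) (y x : ℕ) :
    (downMove j j' a).rows y x = a.rows y x +
      if y = j.val + 1 then movedSum (fun c => a c j) (fun c => a c j') x else 0 := by
  have hne : j ≠ j' := fun h => by rw [h] at hj; omega
  have key (i : Fin n) : (∑ k : Fin m, if k.val < y then downMove j j' a i k else 0) =
      (∑ k : Fin m, if k.val < y then a i k else 0) +
        if y = j.val + 1 then moved (fun c => a c j) (fun c => a c j') i else 0 := by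
    set t := moved (fun c => a c j) (fun c => a c j') i with ht
    have e (k : Fin m) : (if k.val < y then downMove j j' a i k else 0) =
        (if k.val < y then a i k else 0) + ((if k = j then if j.val < y then t else 0 else 0) -
          if k = j' then if j'.val < y then t else 0 else 0) := by
      by_cases h1 : k = j'
      · subst h1
        simp only [downMove, ← ht, if_true, if_neg hne.symm]
        split_ifs <;> ring
      · by_cases h2 : k = j
        · subst h2
          simp only [downMove, ← ht, if_true, if_neg hne]
          split_ifs <;> ring
        · simp [downMove, h1, h2]
    rw [sum_congr rfl fun k _ => e k, sum_add_distrib, sum_sub_distrib]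
    simp only [sum_ite_eq', mem_univ, if_true]
    congr 1
    rcases lt_trichotomy y (j.val + 1) with h | h | h
    · rw [if_neg (by omega), if_neg (by omega), if_neg (by omega), sub_zero]
    · rw [if_pos (by omega), if_neg (by omega), if_pos h, sub_zero]
    · rw [if_pos (by omega), if_pos (by omega), if_neg (by omega), sub_self]
  rw [rows, rows, integral, integral]
  have e (c : MassArray n m) (i : Fin n) :
      (∑ k : Fin m, if i.val < x ∧ k.val < y then c i k else 0) =
        if i.val < x then ∑ k : Fin m, if k.val < y then c i k else 0 else 0 := by
    by_cases h : i.val < x <;> simp [h]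
  simp only [e, key, movedSum]
  have e' : (if y = j.val + 1 then
      ∑ i : Fin n, (if i.val < x then moved (fun c => a c j) (fun c => a c j') i else 0) else 0) =
      ∑ i : Fin n, if i.val < x then
        (if y = j.val + 1 then moved (fun c => a c j) (fun c => a c j') i else 0) else 0 := by
    by_cases h : y = j.val + 1 <;> simp [h]
  rw [e', ← sum_add_distrib]
  exact sum_congr rfl fun i _ => by split_ifs <;> simp

theorem downMove_lower (a : MassArray n m) {j j' : Fin m} (hj : j'.val = j.val + 1) :
    (fun c => downMove j j' a c j) =
      fun c => a c j + moved (fun c => a c j) (fun c => a c j') c := by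
  have hne : j ≠ j' := fun h => by rw [h] at hj; omega
  funext c
  simp [downMove, hne]

theorem downMove_upper (a : MassArray n m) (j j' : Fin m) :
    (fun c => downMove j j' a c j') =
      fun c => a c j' - moved (fun c => a c j) (fun c => a c j') c := by
  funext c
  simp [downMove]

theorem downMove_nonneg {a : MassArray n m} (ha : ∀ i j, 0 ≤ a i j) (j j' : Fin m) (i : Fin n)
    (k : Fin m) : 0 ≤ downMove j j' a i k := by
  have h1 := moved_nonneg (lo := fun c => a c j) (up := fun c => a c j') (fun c => ha c j') i
  have h2 := moved_le (lo := fun c => a c j) (up := fun c => a c j') (fun c => ha c j)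
    (fun c => ha c j') i
  unfold downMove
  split_ifs
  · linarith
  · linarith [ha i j]
  · exact ha i k

/-- The condensation of a row is not affected by an elementary move into this row. -/
theorem rowOp_rows_downMove {a : MassArray n m} (ha : ∀ i j, 0 ≤ a i j) {j j' : Fin m}
    (hj : j'.val = j.val + 1) :
    AgreeUpTo n (rowOp j (downMove j j' a).rows) (rowOp j a.rows) := by
  intro y x hx
  by_cases h : y = j.val + 1
  · subst h
    -- The row gains `movedSum` and its record loses the same amount.
    rw [rowOp_rows_eq _ hj hx, rowOp_rows_eq _ hj hx, downMove_lower a hj, downMove_upper,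
      record_move (fun c => ha c j') hx, rows_downMove a hj, if_pos rfl]
    ring
  · rw [rowOp_of_ne _ h, rowOp_of_ne _ h, rows_downMove a hj, if_neg h, add_zero]

theorem downMove_eq_self_iff (a : MassArray n m) (j j' : Fin m) :
    downMove j j' a = a ↔ ∀ i, moved (fun c => a c j) (fun c => a c j') i = 0 := by
  constructor
  · intro h i
    have := congr_fun (downMove_upper a j j') i
    simp only [h] at this
    linarith
  · intro h
    funext i k
    unfold downMove
    split_ifs with h1 h2
    · rw [h, sub_zero, h1]
    · rw [h, add_zero, h2]
    · rfl

theorem downMove_eq_self_iff_rowOp {a : MassArray n m} (ha : ∀ i j, 0 ≤ a i j) {j j' : Fin m}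
    (hj : j'.val = j.val + 1) :
    downMove j j' a = a ↔ AgreeUpTo n (rowOp j a.rows) a.rows := by
  rw [downMove_eq_self_iff a j j']
  constructor
  · intro h y x hx
    by_cases hy : y = j.val + 1
    · subst hy
      rw [rowOp_rows_eq a hj hx, record_eq_zero_of_moved_eq_zero (fun c => ha c j') h hx, add_zero]
    · rw [rowOp_of_ne _ hy]
  · intro h
    refine moved_eq_zero_of_record_eq_zero (fun c => ha c j') fun x hx => ?_
    have := h (j + 1) x hx
    rw [rowOp_rows_eq a hj hx] at this
    linarith

theorem DownStep.nonneg {a b : MassArray n m} (h : DownStep a b) (ha : ∀ i j, 0 ≤ a i j) :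
    ∀ i j, 0 ≤ b i j := by
  obtain ⟨j, j', _, rfl⟩ := h
  exact downMove_nonneg ha j j'

theorem DownStep.insertion_rows {a b : MassArray n m} (h : DownStep a b) (ha : ∀ i j, 0 ≤ a i j) :
    AgreeUpTo n (insertion m b.rows) (insertion m a.rows) := by
  obtain ⟨j, j', hj, rfl⟩ := h
  have hm : j.val + 1 < m := hj ▸ j'.isLt
  rw [← insertion_rowOp hm (rows_zero_right _), ← insertion_rowOp hm (rows_zero_right a)]
  exact (rowOp_rows_downMove ha hj).insertion m

theorem nonneg_and_insertion_rows_of_reflTransGen {a b : MassArray n m}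
    (h : Relation.ReflTransGen DownStep a b) (ha : ∀ i j, 0 ≤ a i j) :
    (∀ i j, 0 ≤ b i j) ∧ AgreeUpTo n (insertion m b.rows) (insertion m a.rows) := by
  induction h with
  | refl => exact ⟨ha, .refl _⟩
  | tail _ hbc ih => exact ⟨hbc.nonneg ih.1, (hbc.insertion_rows ih.1).trans ih.2⟩

/-- Finitely many moves `D_j` condense the row `j` completely. -/
theorem exists_reflTransGen_rowOp {j j' : Fin m} (hj : j'.val = j.val + 1) {a : MassArray n m}
    (ha : ∀ i j, 0 ≤ a i j) :
    ∃ b, Relation.ReflTransGen DownStep a b ∧ AgreeUpTo n b.rows (rowOp j a.rows) := by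
  -- Termination measure: a move lowers the record increment at the pivot by one unit or to zero, so
  -- its ceiling strictly drops; the other increments are unchanged.
  induction hN : ∑ i : Fin n, ⌈record (fun c => a c j) (fun c => a c j') (i + 1) -
      record (fun c => a c j) (fun c => a c j') i⌉₊ using Nat.strong_induction_on
      generalizing a with
  | _ N ih =>
    by_cases hfix : downMove j j' a = a
    · exact ⟨a, .refl, ((downMove_eq_self_iff_rowOp ha hj).1 hfix).symm⟩
    · obtain ⟨p, hp0⟩ := not_forall.1 ((downMove_eq_self_iff a j j').not.1 hfix)
      have hp : IsPivot (fun c => a c j) (fun c => a c j') p := by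
        by_contra h
        exact hp0 (moved_of_not_isPivot h)
      have hup : ∀ c, 0 ≤ (fun c => a c j') c := fun c => ha c j'
      have hstep : DownStep a (downMove j j' a) := ⟨j, j', hj, rfl⟩
      have hdiff (i : Fin n) :
          record (fun c => downMove j j' a c j) (fun c => downMove j j' a c j') (i + 1) -
            record (fun c => downMove j j' a c j) (fun c => downMove j j' a c j') i =
          record (fun c => a c j) (fun c => a c j') (i + 1) -
            record (fun c => a c j) (fun c => a c j') i -
              moved (fun c => a c j) (fun c => a c j') i := by
        rw [downMove_lower a hj, downMove_upper, record_move hup i.isLt,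
          record_move hup i.isLt.le, movedSum, movedSum, sum_lt_succ]
        ring
      obtain ⟨b, hab, hb⟩ := ih _ (by
        rw [← hN]
        refine sum_lt_sum (fun i _ => ?_) ⟨p, mem_univ p, ?_⟩
        · rw [hdiff]
          exact Nat.ceil_mono (sub_le_self _ (moved_nonneg hup i))
        · rw [hdiff, hp.moved_eq hup]
          rw [hp.moved_eq hup] at hp0
          have hr := record_mono_succ (fun c => a c j) (fun c => a c j') p
          set r := record (fun c => a c j) (fun c => a c j') (p + 1) -
            record (fun c => a c j) (fun c => a c j') p with hrdef
          have hr0 : 0 < r := by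
            rcases (sub_nonneg.2 hr).eq_or_lt with h | h
            · rw [← hrdef] at h
              exact absurd (by rw [← h]; simp) hp0
            · exact h
          have hc : 0 < ⌈r⌉₊ := Nat.ceil_pos.2 hr0
          rcases le_total 1 r with h | h
          · rw [min_eq_left h, Nat.ceil_sub_one]
            omega
          · rw [min_eq_right h, sub_self, Nat.ceil_zero]
            exact hc) (hstep.nonneg ha) rfl
      exact ⟨b, .head hstep hab, hb.trans (rowOp_rows_downMove ha hj)⟩

theorem exists_reflTransGen_sweep {k : ℕ} (hk : k < m) {a : MassArray n m}
    (ha : ∀ i j, 0 ≤ a i j) :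
    ∃ b, Relation.ReflTransGen DownStep a b ∧ AgreeUpTo n b.rows (sweep k a.rows) := by
  induction k generalizing a with
  | zero => exact ⟨a, .refl, .refl _⟩
  | succ k ih =>
    obtain ⟨b, hab, hb⟩ := exists_reflTransGen_rowOp (j := ⟨k, by omega⟩) (j' := ⟨k + 1, hk⟩) rfl ha
    obtain ⟨c, hbc, hc⟩ := ih (by omega) (nonneg_and_insertion_rows_of_reflTransGen hab ha).1
    exact ⟨c, hab.trans hbc, hc.trans (hb.sweep k)⟩

theorem exists_reflTransGen_insertion {z : ℕ} (hz : z ≤ m) {a : MassArray n m}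
    (ha : ∀ i j, 0 ≤ a i j) :
    ∃ b, Relation.ReflTransGen DownStep a b ∧ AgreeUpTo n b.rows (insertion z a.rows) := by
  induction z with
  | zero => exact ⟨a, .refl, .refl _⟩
  | succ z ih =>
    obtain ⟨b, hab, hb⟩ := ih (by omega)
    obtain ⟨c, hbc, hc⟩ := exists_reflTransGen_sweep (k := z) (by omega)
      (nonneg_and_insertion_rows_of_reflTransGen hab ha).1
    exact ⟨c, hab.trans hbc, hc.trans (hb.sweep z)⟩

theorem IsDownCondensation.rows_eq {a d : MassArray n m} (h : a.IsDownCondensation d)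
    (ha : ∀ i j, 0 ≤ a i j) : AgreeUpTo n d.rows (insertion m a.rows) := by
  obtain ⟨hd, hins⟩ := nonneg_and_insertion_rows_of_reflTransGen h.1 ha
  -- Tightness makes `d` its own insertion, and insertion is invariant along the moves from `a`.
  refine (AgreeUpTo.insertion_of_fixed fun j hj => ?_).symm.trans hins
  exact (downMove_eq_self_iff_rowOp hd (j := ⟨j, by omega⟩) (j' := ⟨j + 1, hj⟩) rfl).1 (h.2 _ _ rfl)

theorem existsUnique_isDownCondensation {a : MassArray n m} (ha : ∀ i j, 0 ≤ a i j) :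
    ∃! d, a.IsDownCondensation d := by
  obtain ⟨d, had, hd⟩ := exists_reflTransGen_insertion le_rfl ha
  refine ⟨d, ⟨had, fun j j' hj => ?_⟩, fun d' hd' =>
    eq_of_agreeUpTo ((hd'.rows_eq ha).trans hd.symm)⟩
  rw [downMove_eq_self_iff_rowOp (nonneg_and_insertion_rows_of_reflTransGen had ha).1 hj]
  have h := hd.rowOp j
  rw [rowOp_insertion (hj ▸ j'.isLt) (rows_zero_right a)] at h
  exact h.trans hd.symm

theorem existsUnique_isLeftCondensation {a : MassArray n m} (ha : ∀ i j, 0 ≤ a i j) :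
    ∃! l, a.IsLeftCondensation l := by
  obtain ⟨d, hd, huniq⟩ := existsUnique_isDownCondensation (a := a.transpose) fun i j => ha j i
  exact ⟨d.transpose, hd, fun l hl => congr_arg transpose (huniq _ hl)⟩

end Rows

end MassArray

/-! ### Symmetry of the octant and left-condensations. -/

/-- The octahedron recurrence, in its form symmetric in the first and the third coordinate, on the
whole octant `x, y, z ≥ 0`, from zero values on the three coordinate planes. -/
structure IsOctantPropagation (K : ℕ → ℕ → ℕ → ℝ) : Prop where
  zero_left : ∀ y z, K 0 y z = 0
  zero_mid : ∀ x z, K x 0 z = 0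
  zero_right : ∀ x y, K x y 0 = 0
  recurrence : ∀ x y z, K (x + 1) (y + 1) (z + 1) =
    max (K (x + 1) (y + 1) z + K x (y + 1) (z + 1)) (K x y z + K (x + 1) (y + 2) (z + 1)) -
      K x (y + 1) z

theorem IsOctantPropagation.swap {K : ℕ → ℕ → ℕ → ℝ} (h : IsOctantPropagation K) :
    IsOctantPropagation fun x y z => K z y x where
  zero_left y z := h.zero_right z y
  zero_mid x z := h.zero_mid z x
  zero_right x y := h.zero_left y x
  recurrence x y z := by rw [h.recurrence z y x, add_comm (K (z + 1) (y + 1) x)]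

/-- The recurrence determines a value from smaller `x` or `z`, or from the same `x`, `z` and larger
`y`; hence the descending induction on `y` from the region `y ≥ max x z`. -/
theorem IsOctantPropagation.unique {K K' : ℕ → ℕ → ℕ → ℝ} (h : IsOctantPropagation K)
    (h' : IsOctantPropagation K') (heq : ∀ x y z, max x z ≤ y → K x y z = K' x y z) (x y z : ℕ) :
    K x y z = K' x y z := by
  induction x generalizing y z with
  | zero => rw [h.zero_left, h'.zero_left]
  | succ x ihx =>
    induction z generalizing y with
    | zero => rw [h.zero_right, h'.zero_right]
    | succ z ihz =>
      by_cases hy : max (x + 1) (z + 1) ≤ y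
      · exact heq _ _ _ hy
      · refine Nat.decreasingInduction (motive := fun y _ => K (x + 1) y (z + 1) =
          K' (x + 1) y (z + 1)) (fun y _ ih => ?_) (heq _ _ _ le_rfl) (not_le.1 hy).le
        cases y with
        | zero => rw [h.zero_mid, h'.zero_mid]
        | succ y => rw [h.recurrence, h'.recurrence, ihz, ihx, ihx, ih, ihx]

theorem IsOctahedronPropagation.unique {n m : ℕ} {f : ℕ → ℕ → ℝ} {F F' : ℕ → ℕ → ℕ → ℝ}
    (h : IsOctahedronPropagation n m f F) (h' : IsOctahedronPropagation n m f F') {x y z : ℕ}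
    (hx : x ≤ n) (hyz : y ≤ z) (hz : z ≤ m) : F x y z = F' x y z := by
  induction x generalizing y z with
  | zero => rw [h.left y z hyz hz, h'.left y z hyz hz]
  | succ x ihx =>
    induction z generalizing y with
    | zero =>
      obtain rfl : y = 0 := by omega
      rw [h.front _ _ hx hz, h'.front _ _ hx hz]
    | succ z ihz =>
      refine Nat.decreasingInduction (motive := fun y _ => F (x + 1) y (z + 1) =
        F' (x + 1) y (z + 1)) (fun y hy ih => ?_) ?_ hyz
      · rcases Nat.eq_zero_or_pos y with rfl | hy0
        · rw [h.front _ _ hx hz, h'.front _ _ hx hz]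
        · rw [h.recurrence x y z hx hy0 (by omega) hz, h'.recurrence x y z hx hy0 (by omega) hz, ih,
            ihz (by omega) (by omega), ihx (by omega) (by omega) hz,
            ihx (by omega) (by omega) (by omega), ihx (by omega) (by omega) (by omega)]
      · rw [h.slope _ _ hx hz, h'.slope _ _ hx hz]

namespace MassArray

variable {n m : ℕ}

theorem isOctahedronPropagation_insertion (a : MassArray n m) :
    IsOctahedronPropagation n m a.integral fun x y z => insertion z a.rows y x where
  front x z _ _ := by rw [insertion_zero_left, rows_zero_left]
  left y z _ _ := insertion_zero_right (rows_zero_right a) z y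
  slope x y _ _ := by rw [insertion_of_le le_rfl, rows]
  recurrence x y z _ hy hyz _ := by
    obtain ⟨y, rfl⟩ := Nat.exists_eq_add_of_le' hy
    rw [insertion_recurrence (by omega), Nat.add_sub_cancel, add_comm (insertion z a.rows y x)]

/-- The insertion process as a function on the octant, constant in `y ≥ z`. -/
noncomputable def octant (a : MassArray n m) (x y z : ℕ) : ℝ :=
  if y ≤ z then insertion z a.rows y x else a.rows z x

theorem octant_of_le (a : MassArray n m) {x y z : ℕ} (h : z ≤ y) :
    a.octant x y z = a.rows z x := by
  unfold octant
  split_ifs with h'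
  · obtain rfl : y = z := le_antisymm h' h
    rw [insertion_of_le le_rfl]
  · rfl

theorem rows_supermodular {a : MassArray n m} (ha : ∀ i j, 0 ≤ a i j) (x z : ℕ) :
    a.rows z (x + 1) + a.rows (z + 1) x ≤ a.rows (z + 1) (x + 1) + a.rows z x := by
  simp only [rows, integral, ← sum_add_distrib]
  refine sum_le_sum fun i _ => sum_le_sum fun j _ => ?_
  have := ha i j
  split_ifs <;> first | omega | linarith

/-- Below the slope this is the insertion recurrence. In the constant region, supermodularity of the
integral of a non-negative array selects the second branch of the maximum. -/
theorem isOctantPropagation_octant {a : MassArray n m} (ha : ∀ i j, 0 ≤ a i j) :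
    IsOctantPropagation a.octant where
  zero_left y z := by
    unfold octant
    rw [insertion_zero_right (rows_zero_right a), rows_zero_right, ite_self]
  zero_mid x z := by rw [octant, if_pos z.zero_le, insertion_zero_left, rows_zero_left]
  zero_right x y := by rw [octant_of_le a y.zero_le, rows_zero_left]
  recurrence x y z := by
    rcases Nat.lt_or_ge y z with h | h
    · simp only [octant]
      rw [if_pos (by omega), if_pos (by omega), if_pos (by omega), if_pos (by omega),
        if_pos (by omega), if_pos (by omega), insertion_recurrence h,
        add_comm (insertion z a.rows y x)]
    · rw [octant_of_le a (by omega), octant_of_le a (by omega), octant_of_le a (by omega),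
        octant_of_le a h, octant_of_le a (by omega), octant_of_le a (by omega),
        max_eq_right (by linarith [rows_supermodular ha x z])]
      ring

/-- For `y ≥ max x z` both sides are the plain integral of `a` at `(x, z)`, and this region
determines the solution. -/
theorem octant_transpose {a : MassArray n m} (ha : ∀ i j, 0 ≤ a i j) (x y z : ℕ) :
    a.transpose.octant z y x = a.octant x y z := by
  refine (isOctantPropagation_octant (a := a.transpose) fun i j => ha j i).swap.unique
    (isOctantPropagation_octant ha) (fun x y z h => ?_) x y z
  rw [octant_of_le _ (le_of_max_le_left h), octant_of_le _ (le_of_max_le_right h), rows_transpose]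

theorem IsLeftCondensation.rows_eq {a l : MassArray n m} (h : a.IsLeftCondensation l)
    (ha : ∀ i j, 0 ≤ a i j) {y z : ℕ} (hz : z ≤ m) : l.rows z y = a.octant n y z := by
  rw [← rows_transpose, ← octant_transpose ha,
    IsDownCondensation.rows_eq h (fun i j => ha j i) y z hz, octant]
  split_ifs with hy
  · rfl
  -- Here `y > n`: the transpose has only `n` rows, so its integral is constant from row `n` on.
  · rw [insertion_of_le (by omega)]
    exact rows_congr_left _ (by omega) le_rfl z

end MassArray

theorem theorem2 (n m : ℕ) (a : MassArray n m) (ha : ∀ i j, 0 ≤ a i j) :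
    (∃! d : MassArray n m, a.IsDownCondensation d) ∧
    (∃! l : MassArray n m, a.IsLeftCondensation l) ∧
    ∀ (F : ℕ → ℕ → ℕ → ℝ), IsOctahedronPropagation n m a.integral F →
      ∀ (d l : MassArray n m), a.IsDownCondensation d → a.IsLeftCondensation l →
        (∀ i j, i ≤ n → j ≤ m → F i j m = d.integral i j) ∧
        (∀ j k, j ≤ k → k ≤ m → F n j k = l.integral j k) := by
  refine ⟨MassArray.existsUnique_isDownCondensation ha,
    MassArray.existsUnique_isLeftCondensation ha, fun F hF d l hd hl => ⟨fun i j hi hj => ?_,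
    fun j k hjk hk => ?_⟩⟩
  · rw [hF.unique a.isOctahedronPropagation_insertion hi hj le_rfl]
    exact (hd.rows_eq ha j i hi).symm
  · rw [hF.unique a.isOctahedronPropagation_insertion le_rfl hjk hk]
    have h := hl.rows_eq ha (y := j) hk
    rw [MassArray.octant, if_pos hjk] at h
    exact h.symm
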